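/- Let $d$ be a positive integer and let $G=U(d^2)$ be the group of unitary operators on $\mathbb C^d\otimes\mathbb C^d$ (the $2$-qudit gates), written as matrices in the orthonormal basis $e_i\otimes e_j$. Let $H\subseteq G$ be the subgroup $H=\{S\otimes T : S,T\in U(d)\}$. Call $V\in G$ primitive if for all unit vectors $x,y\in\mathbb C^d$ there are unit vectors $u,v\in\mathbb C^d$ such that $V(x\otimes y)=u\otimes v$. Then the normalizer of $H$ in $G$ is exactly the set $L$ of primitive elements of $G$: $$N_G(H)=\{R\in G : RHR^{-1}=H\}=L .$$ In particular $L$ is a subgroup of $G$. -/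

import Mathlib

open scoped Kronecker Matrix

namespace QuditGates

/-- The group `U(d)` of `1`-qudit gates. -/
abbrev OneGate (d : ℕ) : Type := ↥(Matrix.unitaryGroup (Fin d) ℂ)

/-- The group `U(d²)` of `2`-qudit gates, as unitary matrices in the computational basis
`|i j⟩ = |i⟩ ⊗ |j⟩` of `ℂ^d ⊗ ℂ^d`, which is indexed by the pairs `(i, j)`. -/
abbrev TwoGate (d : ℕ) : Type := ↥(Matrix.unitaryGroup (Fin d × Fin d) ℂ)

/-- The coordinates of `|x y⟩ = |x⟩ ⊗ |y⟩` in the computational basis. -/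
def ketTensor {d : ℕ} (x y : EuclideanSpace ℂ (Fin d)) : Fin d × Fin d → ℂ :=
  fun p => x p.1 * y p.2

/-- A `2`-qudit gate `V` is primitive if for all qudits (unit vectors) `x`, `y` there are
qudits `u`, `v` with `V |x y⟩ = |u v⟩`. -/
def IsPrimitive {d : ℕ} (V : TwoGate d) : Prop :=
  ∀ x y : EuclideanSpace ℂ (Fin d), ‖x‖ = 1 → ‖y‖ = 1 →
    ∃ u v : EuclideanSpace ℂ (Fin d), ‖u‖ = 1 ∧ ‖v‖ = 1 ∧
      (V : Matrix (Fin d × Fin d) (Fin d × Fin d) ℂ) *ᵥ ketTensor x y = ketTensor u v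

/-- The `2`-qudit gate `S ⊗ T`. -/
def tensorGate {d : ℕ} (S T : OneGate d) : TwoGate d :=
  ⟨(S : Matrix (Fin d) (Fin d) ℂ) ⊗ₖ (T : Matrix (Fin d) (Fin d) ℂ),
    Matrix.kronecker_mem_unitary S.2 T.2⟩

theorem tensorGate_mul {d : ℕ} (S T S' T' : OneGate d) :
    tensorGate S T * tensorGate S' T' = tensorGate (S * S') (T * T') :=
  Subtype.ext (Matrix.mul_kronecker_mul _ _ _ _).symm

theorem tensorGate_one (d : ℕ) : tensorGate (1 : OneGate d) 1 = 1 :=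
  Subtype.ext Matrix.one_kronecker_one

/-- `S ⊗ T` acts on decomposable vectors by `|x y⟩ ↦ S|x⟩ ⊗ T|y⟩`. -/
theorem tensorGate_mulVec {d : ℕ} (S T : OneGate d) (x y : EuclideanSpace ℂ (Fin d)) :
    (tensorGate S T : Matrix (Fin d × Fin d) (Fin d × Fin d) ℂ) *ᵥ ketTensor x y =
      ketTensor (WithLp.toLp 2 ((S : Matrix (Fin d) (Fin d) ℂ) *ᵥ x.ofLp))
        (WithLp.toLp 2 ((T : Matrix (Fin d) (Fin d) ℂ) *ᵥ y.ofLp)) := by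
  funext p
  simp only [Matrix.mulVec, dotProduct, ketTensor, tensorGate, Matrix.kroneckerMap_apply,
    Fintype.sum_prod_type, Finset.sum_mul_sum]
  exact Finset.sum_congr rfl fun i _ => Finset.sum_congr rfl fun j _ => by ring

/-- The subgroup `H` of `U(d²)` of all the gates `S ⊗ T` with `S, T ∈ U(d)`. -/
def tensorSubgroup (d : ℕ) : Subgroup (TwoGate d) where
  carrier := {V | ∃ S T : OneGate d, V = tensorGate S T}
  mul_mem' := by
    rintro _ _ ⟨S, T, rfl⟩ ⟨S', T', rfl⟩
    exact ⟨S * S', T * T', tensorGate_mul S T S' T'⟩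
  one_mem' := ⟨1, 1, (tensorGate_one d).symm⟩
  inv_mem' := by
    rintro _ ⟨S, T, rfl⟩
    refine ⟨S⁻¹, T⁻¹, inv_eq_of_mul_eq_one_right ?_⟩
    rw [tensorGate_mul, mul_inv_cancel, mul_inv_cancel, tensorGate_one]

/-- `H` is the subgroup generated by the gates `A(1) = A ⊗ I` and `A(2) = I ⊗ A`. -/
theorem tensorSubgroup_eq_closure (d : ℕ) :
    tensorSubgroup d =
      Subgroup.closure ({V | ∃ A : OneGate d, V = tensorGate A 1 ∨ V = tensorGate 1 A}) := by
  apply le_antisymm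
  · rintro _ ⟨S, T, rfl⟩
    have h : tensorGate S T = tensorGate S 1 * tensorGate 1 T := by
      rw [tensorGate_mul, mul_one, one_mul]
    rw [h]
    exact mul_mem (Subgroup.subset_closure ⟨S, Or.inl rfl⟩)
      (Subgroup.subset_closure ⟨T, Or.inr rfl⟩)
  · rw [Subgroup.closure_le]
    rintro _ ⟨A, rfl | rfl⟩
    · exact ⟨A, 1, rfl⟩
    · exact ⟨1, A, rfl⟩

end QuditGates

/-! Everything runs through the gates 1 + (z - 1)P with P = xxᴴ ⊗ 1 or 1 ⊗ yyᴴ, z a phase. If V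
normalizes H, then 1 + (z - 1)VPVᴴ is a tensor for every z. Being a tensor is a system of quadratic
equations, so VPVᴴ is itself a tensor (`IsTensor.of_one_add_smul`). Multiplying the two cases gives
the projection onto V(x ⊗ y), which is thus a tensor, so V(x ⊗ y) is decomposable. Conversely, let V
be primitive and x a unit vector. The vectors V(x ⊗ y) form a linear space of decomposable vectors,
so they share a factor (`exists_common_factor`), and a dimension count makes the projection V(xxᴴ ⊗
1)Vᴴ equal to uuᴴ ⊗ 1 or 1 ⊗ uuᴴ. Whether the side depends on x is irrelevant: either way V
conjugates the phase gate into H. Phase gates generate U(d) (`closure_phaseGate`), so VHV⁻¹ ⊆ H;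
equality follows from the same inclusion for V⁻¹ (`IsPrimitive.inv`). -/

namespace QuditGates
open Matrix

/-! ### Decomposable vectors and matrices, cut out by quadratic equations. -/

/-- The decomposable vector `a ⊗ b`. -/
def prodVec {m n : Type*} (a : m → ℂ) (b : n → ℂ) : m × n → ℂ := fun p => a p.1 * b p.2

/-- A vector is decomposable if it is of the form `a ⊗ b`. -/
def IsProductVec {m n : Type*} (w : m × n → ℂ) : Prop := ∃ a b, w = prodVec a b

theorem isProductVec_iff_minors {m n : Type*} (w : m × n → ℂ) :
    IsProductVec w ↔ ∀ i j k l, w (i, j) * w (k, l) = w (i, l) * w (k, j) := by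
  constructor
  · rintro ⟨a, b, rfl⟩ i j k l
    simp only [prodVec]; ring
  · intro h
    by_cases h0 : ∀ p, w p = 0
    · exact ⟨0, 0, by funext p; simp [prodVec, h0]⟩
    · push Not at h0
      obtain ⟨⟨k, l⟩, hp⟩ := h0
      refine ⟨fun i => w (i, l), fun j => w (k, j) / w (k, l), ?_⟩
      funext ⟨i, j⟩
      simp only [prodVec]
      rw [mul_div_assoc', eq_div_iff hp]
      exact h i j k l

/-- A matrix on `ℂ^m ⊗ ℂ^n` is decomposable if it is of the form `C ⊗ D`. -/
def IsTensor {m n : Type*} (M : Matrix (m × n) (m × n) ℂ) : Prop :=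
  ∃ (C : Matrix m m ℂ) (D : Matrix n n ℂ), M = C ⊗ₖ D

/-- The rank-one criterion again, for M rearranged with rows (i, k) and columns (j, l). -/
theorem isTensor_iff_minors {m n : Type*} (M : Matrix (m × n) (m × n) ℂ) :
    IsTensor M ↔ ∀ i j k l i' j' k' l',
      M (i, j) (k, l) * M (i', j') (k', l') = M (i, j') (k, l') * M (i', j) (k', l) := by
  constructor
  · rintro ⟨C, D, rfl⟩ i j k l i' j' k' l'
    simp only [kroneckerMap_apply]; ring
  · intro h
    by_cases h0 : ∀ p q, M p q = 0
    · exact ⟨0, 0, by ext p q; simp [h0]⟩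
    · push Not at h0
      obtain ⟨⟨i', j'⟩, ⟨k', l'⟩, hp⟩ := h0
      refine ⟨of fun i k => M (i, j') (k, l'),
        of fun j l => M (i', j) (k', l) / M (i', j') (k', l'), ?_⟩
      ext ⟨i, j⟩ ⟨k, l⟩
      simp only [kroneckerMap_apply, of_apply]
      rw [mul_div_assoc', eq_div_iff hp]
      exact h i j k l i' j' k' l'

theorem IsTensor.mul {m n : Type*} [Fintype m] [Fintype n] {M N : Matrix (m × n) (m × n) ℂ}
    (hM : IsTensor M) (hN : IsTensor N) : IsTensor (M * N) := by
  obtain ⟨C, D, rfl⟩ := hM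
  obtain ⟨C', D', rfl⟩ := hN
  exact ⟨C * C', D * D', (mul_kronecker_mul _ _ _ _).symm⟩

/-- If the affine line `1 + tQ` meets the decomposable matrices in two points other than `1`,
then its direction is decomposable. -/
theorem IsTensor.of_one_add_smul {m n : Type*} [DecidableEq m] [DecidableEq n]
    {Q : Matrix (m × n) (m × n) ℂ} {s t : ℂ} (hs : s ≠ 0) (ht : t ≠ 0) (hst : s ≠ t)
    (h₁ : IsTensor (1 + s • Q)) (h₂ : IsTensor (1 + t • Q)) : IsTensor Q := by
  have h₀ : IsTensor (1 : Matrix (m × n) (m × n) ℂ) := ⟨1, 1, one_kronecker_one.symm⟩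
  rw [isTensor_iff_minors] at *
  intro i j k l i' j' k' l'
  have e₀ := h₀ i j k l i' j' k' l'
  have e₁ := h₁ i j k l i' j' k' l'
  have e₂ := h₂ i j k l i' j' k' l'
  simp only [Matrix.add_apply, Matrix.smul_apply, smul_eq_mul] at e₁ e₂
  have hne : s * t * (s - t) ≠ 0 := mul_ne_zero (mul_ne_zero hs ht) (sub_ne_zero.2 hst)
  apply mul_left_cancel₀ hne
  -- Each minor is quadratic along the line; this second difference isolates its leading
  -- coefficient, the minor of Q.
  linear_combination t * e₁ - s * e₂ + (s - t) * e₀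

/-- Any column of C ⊗ D is decomposable, and a column of w wᴴ at a nonzero entry of w is a nonzero
multiple of w. -/
theorem IsProductVec.of_isTensor_vecMulVec {m n : Type*} {w : m × n → ℂ}
    (h : IsTensor (vecMulVec w (star w))) : IsProductVec w := by
  by_cases h0 : ∀ p, w p = 0
  · exact ⟨0, 0, by funext p; simp [prodVec, h0]⟩
  · push Not at h0
    obtain ⟨⟨k, l⟩, hp⟩ := h0
    obtain ⟨C, D, h⟩ := h
    refine ⟨fun i => C i k, fun j => D j l / star (w (k, l)), ?_⟩
    funext ⟨i, j⟩
    have := congrFun (congrFun h (i, j)) (k, l)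
    simp only [vecMulVec_apply, kroneckerMap_apply, Pi.star_apply] at this
    simp only [prodVec]
    rw [mul_div_assoc', eq_div_iff (star_ne_zero.2 hp), this]

theorem star_prodVec {m n : Type*} (a : m → ℂ) (b : n → ℂ) :
    star (prodVec a b) = prodVec (star a) (star b) := by
  funext p; simp [prodVec]

theorem prodVec_dotProduct_prodVec {m n : Type*} [Fintype m] [Fintype n] (a a' : m → ℂ)
    (b b' : n → ℂ) : prodVec a b ⬝ᵥ prodVec a' b' = (a ⬝ᵥ a') * (b ⬝ᵥ b') := by
  simp only [dotProduct, prodVec, Fintype.sum_prod_type, Finset.sum_mul_sum]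
  exact Finset.sum_congr rfl fun i _ => Finset.sum_congr rfl fun j _ => by ring

theorem vecMulVec_prodVec {m n : Type*} (a a' : m → ℂ) (b b' : n → ℂ) :
    vecMulVec (prodVec a b) (prodVec a' b') = vecMulVec a a' ⊗ₖ vecMulVec b b' := by
  ext ⟨i, j⟩ ⟨k, l⟩
  simp only [vecMulVec_apply, prodVec, kroneckerMap_apply]; ring

theorem smul_prodVec {m n : Type*} (c : ℂ) (a : m → ℂ) (b : n → ℂ) :
    c • prodVec a b = prodVec (c • a) b := by
  funext p; simp [prodVec, mul_assoc]

theorem prodVec_smul {m n : Type*} (c : ℂ) (a : m → ℂ) (b : n → ℂ) :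
    prodVec a (c • b) = c • prodVec a b := by
  funext p; simp [prodVec, mul_left_comm]

/-! ### Unit vectors, unitaries and phase gates. -/

theorem norm_eq_one_iff_dotProduct {n : Type*} [Fintype n] (x : EuclideanSpace ℂ n) :
    ‖x‖ = 1 ↔ star x.ofLp ⬝ᵥ x.ofLp = 1 := by
  have h : star x.ofLp ⬝ᵥ x.ofLp = ((‖x‖ ^ 2 : ℝ) : ℂ) := by
    rw [dotProduct_comm, ← EuclideanSpace.inner_eq_star_dotProduct, inner_self_eq_norm_sq_to_K]
    simp
  rw [h]
  norm_cast
  rw [pow_eq_one_iff_of_nonneg (norm_nonneg _) two_ne_zero]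

theorem exists_smul_unit {n : Type*} [Fintype n] {a : n → ℂ} (ha : a ≠ 0) :
    ∃ (c : ℂ) (u : n → ℂ), c ≠ 0 ∧ star u ⬝ᵥ u = 1 ∧ a = c • u := by
  have h : ‖WithLp.toLp 2 a‖ ≠ 0 := by simpa using ha
  have hc : ((‖WithLp.toLp 2 a‖ : ℝ) : ℂ) ≠ 0 := by exact_mod_cast h
  refine ⟨(‖WithLp.toLp 2 a‖ : ℂ), (‖WithLp.toLp 2 a‖ : ℂ)⁻¹ • a, hc, ?_, ?_⟩
  · refine (norm_eq_one_iff_dotProduct (WithLp.toLp 2 ((‖WithLp.toLp 2 a‖ : ℂ)⁻¹ • a))).1 ?_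
    rw [WithLp.toLp_smul, norm_smul]
    simp [h]
  · rw [smul_smul, mul_inv_cancel₀ hc, one_smul]

theorem star_mulVec_dotProduct_mulVec {n : Type*} [Fintype n] [DecidableEq n]
    (U : unitaryGroup n ℂ) (x y : n → ℂ) :
    star ((U : Matrix n n ℂ) *ᵥ x) ⬝ᵥ ((U : Matrix n n ℂ) *ᵥ y) = star x ⬝ᵥ y := by
  rw [star_mulVec, ← dotProduct_mulVec, mulVec_mulVec, ← star_eq_conjTranspose,
    UnitaryGroup.star_mul_self, one_mulVec]

theorem isPrimitive_iff {d : ℕ} (V : TwoGate d) :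
    IsPrimitive V ↔ ∀ a b : Fin d → ℂ,
      IsProductVec ((V : Matrix (Fin d × Fin d) (Fin d × Fin d) ℂ) *ᵥ prodVec a b) := by
  constructor
  · intro h a b
    by_cases ha : a = 0
    · exact ⟨0, 0, by subst ha; funext p; simp [prodVec, mulVec, dotProduct]⟩
    by_cases hb : b = 0
    · exact ⟨0, 0, by subst hb; funext p; simp [prodVec, mulVec, dotProduct]⟩
    obtain ⟨c, x, -, hx, rfl⟩ := exists_smul_unit ha
    obtain ⟨e, y, -, hy, rfl⟩ := exists_smul_unit hb
    obtain ⟨u, v, -, -, huv⟩ := h (WithLp.toLp 2 x) (WithLp.toLp 2 y)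
      ((norm_eq_one_iff_dotProduct _).2 hx) ((norm_eq_one_iff_dotProduct _).2 hy)
    refine ⟨(e * c) • u.ofLp, v.ofLp, ?_⟩
    rw [prodVec_smul, ← smul_prodVec, smul_smul, mulVec_smul, ← smul_prodVec]
    exact congrArg _ huv
  · intro h x y hx hy
    rw [norm_eq_one_iff_dotProduct] at hx hy
    obtain ⟨a, b, hab⟩ := h x.ofLp y.ofLp
    have h1 := star_mulVec_dotProduct_mulVec V (prodVec x.ofLp y.ofLp) (prodVec x.ofLp y.ofLp)
    rw [hab, star_prodVec, star_prodVec, prodVec_dotProduct_prodVec, prodVec_dotProduct_prodVec,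
      hx, hy, mul_one] at h1
    have ha : a ≠ 0 := by rintro rfl; simp at h1
    obtain ⟨c, u, -, hu, rfl⟩ := exists_smul_unit ha
    refine ⟨WithLp.toLp 2 u, WithLp.toLp 2 (c • b), (norm_eq_one_iff_dotProduct _).2 hu,
      (norm_eq_one_iff_dotProduct _).2 ?_, ?_⟩
    · simp only [star_smul, smul_dotProduct, dotProduct_smul, smul_eq_mul, hu] at h1 ⊢
      linear_combination h1
    · refine hab.trans ?_
      rw [← smul_prodVec, ← prodVec_smul]
      rfl

/-- The unitary `1 + (z - 1) u uᴴ`, which multiplies the unit vector `u` by the phase `z` and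
fixes the orthogonal complement of `u`. -/
def phaseGate {n : Type*} [Fintype n] [DecidableEq n] (z : Circle) (u : n → ℂ)
    (hu : star u ⬝ᵥ u = 1) : unitaryGroup n ℂ :=
  ⟨1 + ((z : ℂ) - 1) • vecMulVec u (star u), by
    have hz : (starRingEnd ℂ) z * (z : ℂ) = 1 := by
      rw [← Complex.normSq_eq_conj_mul_self, Circle.normSq_coe, Complex.ofReal_one]
    rw [mem_unitaryGroup_iff', star_eq_conjTranspose, conjTranspose_add, conjTranspose_smul,
      conjTranspose_vecMulVec, star_star, conjTranspose_one, add_mul, mul_add, mul_add, smul_mul_smul,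
      vecMulVec_mul_vecMulVec, hu, one_smul, one_mul, one_mul, mul_one, add_assoc, ← add_smul,
      ← add_smul]
    convert add_zero _
    convert zero_smul ℂ _
    simp only [star_sub, star_one, RCLike.star_def]
    linear_combination hz⟩

theorem coe_phaseGate {n : Type*} [Fintype n] [DecidableEq n] (z : Circle) (u : n → ℂ)
    (hu : star u ⬝ᵥ u = 1) :
    (phaseGate z u hu : Matrix n n ℂ) = 1 + ((z : ℂ) - 1) • vecMulVec u (star u) := rfl

theorem phaseGate_mulVec {n : Type*} [Fintype n] [DecidableEq n] (z : Circle) (u : n → ℂ)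
    (hu : star u ⬝ᵥ u = 1) (x : n → ℂ) :
    (phaseGate z u hu : Matrix n n ℂ) *ᵥ x = x + (((z : ℂ) - 1) * (star u ⬝ᵥ x)) • u := by
  rw [coe_phaseGate, add_mulVec, one_mulVec, smul_mulVec, vecMulVec_mulVec, op_smul_eq_smul,
    smul_smul]

theorem coe_tensorGate_phaseGate_one {d : ℕ} (z : Circle) (u : Fin d → ℂ)
    (hu : star u ⬝ᵥ u = 1) :
    (tensorGate (phaseGate z u hu) 1 : Matrix (Fin d × Fin d) (Fin d × Fin d) ℂ) =
      1 + ((z : ℂ) - 1) • (vecMulVec u (star u) ⊗ₖ (1 : Matrix (Fin d) (Fin d) ℂ)) := by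
  change (phaseGate z u hu : Matrix (Fin d) (Fin d) ℂ) ⊗ₖ (1 : Matrix (Fin d) (Fin d) ℂ) = _
  rw [coe_phaseGate, add_kronecker, one_kronecker_one, smul_kronecker]

theorem coe_tensorGate_one_phaseGate {d : ℕ} (z : Circle) (u : Fin d → ℂ)
    (hu : star u ⬝ᵥ u = 1) :
    (tensorGate 1 (phaseGate z u hu) : Matrix (Fin d × Fin d) (Fin d × Fin d) ℂ) =
      1 + ((z : ℂ) - 1) • ((1 : Matrix (Fin d) (Fin d) ℂ) ⊗ₖ vecMulVec u (star u)) := by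
  change (1 : Matrix (Fin d) (Fin d) ℂ) ⊗ₖ (phaseGate z u hu : Matrix (Fin d) (Fin d) ℂ) = _
  rw [coe_phaseGate, kronecker_add, one_kronecker_one, kronecker_smul]

/-! ### Elements of the normalizer are primitive. -/

theorem unitary_conj_one_add_smul {n : Type*} [Fintype n] [DecidableEq n]
    (V : unitaryGroup n ℂ) (t : ℂ) (P : Matrix n n ℂ) :
    (V : Matrix n n ℂ) * (1 + t • P) * (V : Matrix n n ℂ)ᴴ =
      1 + t • ((V : Matrix n n ℂ) * P * (V : Matrix n n ℂ)ᴴ) := by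
  have h : (V : Matrix n n ℂ) * (V : Matrix n n ℂ)ᴴ = 1 := mem_unitaryGroup_iff.1 V.2
  rw [mul_add, add_mul, mul_one, h, Matrix.mul_smul, Matrix.smul_mul]

theorem isTensor_of_mem_tensorSubgroup {d : ℕ} {V : TwoGate d} (h : V ∈ tensorSubgroup d) :
    IsTensor (V : Matrix (Fin d × Fin d) (Fin d × Fin d) ℂ) := by
  obtain ⟨S, T, rfl⟩ := h
  exact ⟨S, T, rfl⟩

theorem isTensor_conj_of_phases {d : ℕ} {V : TwoGate d}
    {P : Matrix (Fin d × Fin d) (Fin d × Fin d) ℂ} (g : Circle → TwoGate d)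
    (hg : ∀ z, (g z : Matrix (Fin d × Fin d) (Fin d × Fin d) ℂ) = 1 + ((z : ℂ) - 1) • P)
    (h : ∀ z, V * g z * V⁻¹ ∈ tensorSubgroup d) :
    IsTensor ((V : Matrix (Fin d × Fin d) (Fin d × Fin d) ℂ) * P *
      (V : Matrix (Fin d × Fin d) (Fin d × Fin d) ℂ)ᴴ) := by
  have key : ∀ z : Circle, IsTensor (1 + ((z : ℂ) - 1) •
      ((V : Matrix (Fin d × Fin d) (Fin d × Fin d) ℂ) * P *
        (V : Matrix (Fin d × Fin d) (Fin d × Fin d) ℂ)ᴴ)) := by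
    intro z
    rw [← unitary_conj_one_add_smul, ← hg]
    exact isTensor_of_mem_tensorSubgroup (h z)
  -- The phases -1 and i give two distinct nonzero parameters z - 1.
  have k₁ := key (-1)
  have k₂ := key ⟨Complex.I, by simp [Submonoid.unitSphere]⟩
  refine IsTensor.of_one_add_smul ?_ ?_ ?_ k₁ k₂
  · norm_num
  · simp [Complex.ext_iff]
  · simp [Complex.ext_iff]

theorem isPrimitive_of_conj_mem {d : ℕ} {V : TwoGate d}
    (h : ∀ g ∈ tensorSubgroup d, V * g * V⁻¹ ∈ tensorSubgroup d) : IsPrimitive V := by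
  rw [isPrimitive_iff]
  intro a b
  by_cases ha : a = 0
  · exact ⟨0, 0, by subst ha; funext p; simp [prodVec, mulVec, dotProduct]⟩
  by_cases hb : b = 0
  · exact ⟨0, 0, by subst hb; funext p; simp [prodVec, mulVec, dotProduct]⟩
  obtain ⟨c, x, -, hx, rfl⟩ := exists_smul_unit ha
  obtain ⟨e, y, -, hy, rfl⟩ := exists_smul_unit hb
  have h₁ := isTensor_conj_of_phases (V := V) _ (coe_tensorGate_phaseGate_one · x hx)
    fun z => h _ ⟨_, _, rfl⟩
  have h₂ := isTensor_conj_of_phases (V := V) _ (coe_tensorGate_one_phaseGate · y hy)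
    fun z => h _ ⟨_, _, rfl⟩
  have h₃ := h₁.mul h₂
  have hV : (V : Matrix (Fin d × Fin d) (Fin d × Fin d) ℂ)ᴴ *
    (V : Matrix (Fin d × Fin d) (Fin d × Fin d) ℂ) = 1 := mem_unitaryGroup_iff'.1 V.2
  have h₄ : IsTensor (vecMulVec
      ((V : Matrix (Fin d × Fin d) (Fin d × Fin d) ℂ) *ᵥ prodVec x y)
      (star ((V : Matrix (Fin d × Fin d) (Fin d × Fin d) ℂ) *ᵥ prodVec x y))) := by
    -- Inserting VᴴV = 1, the product is V(xxᴴ ⊗ yyᴴ)Vᴴ.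
    convert h₃ using 1
    rw [star_mulVec, ← vecMulVec_mul, ← mul_vecMulVec, star_prodVec, vecMulVec_prodVec]
    simp only [mul_assoc]
    rw [← mul_assoc _ᴴ (V : Matrix (Fin d × Fin d) (Fin d × Fin d) ℂ), hV, one_mul,
      ← mul_assoc (_ ⊗ₖ _), ← mul_kronecker_mul, mul_one, one_mul]
  obtain ⟨u, v, huv⟩ := IsProductVec.of_isTensor_vecMulVec h₄
  refine ⟨(e * c) • u, v, ?_⟩
  rw [prodVec_smul, ← smul_prodVec, smul_smul, mulVec_smul, ← smul_prodVec, huv]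

/-! ### Inverses of primitive gates. -/

/-- The inverse of a primitive gate is primitive: the quadratic forms vanishing on all
decomposable vectors form a finite-dimensional space, which `V` maps injectively, hence
surjectively, to itself. -/
theorem IsPrimitive.inv {d : ℕ} {V : TwoGate d} (hV : IsPrimitive V) : IsPrimitive V⁻¹ := by
  rw [isPrimitive_iff] at hV ⊢
  set A : Matrix (Fin d × Fin d) (Fin d × Fin d) ℂ := V.1
  set A' : Matrix (Fin d × Fin d) (Fin d × Fin d) ℂ := (V⁻¹).1
  have hAA' : A * A' = 1 := congrArg Subtype.val (mul_inv_cancel V)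
  let K : Submodule ℂ (Matrix (Fin d × Fin d) (Fin d × Fin d) ℂ) :=
    { carrier := {B | ∀ a b : Fin d → ℂ, prodVec a b ⬝ᵥ B *ᵥ prodVec a b = 0}
      add_mem' := fun {B C} hB hC a b => by
        rw [add_mulVec, dotProduct_add, hB a b, hC a b, add_zero]
      zero_mem' := fun a b => by rw [zero_mulVec, dotProduct_zero]
      smul_mem' := fun c B hB a b => by
        rw [smul_mulVec, dotProduct_smul, hB a b, smul_zero] }
  let φ : Matrix (Fin d × Fin d) (Fin d × Fin d) ℂ →ₗ[ℂ]
      Matrix (Fin d × Fin d) (Fin d × Fin d) ℂ :=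
    (LinearMap.mulLeft ℂ Aᵀ).comp (LinearMap.mulRight ℂ A)
  have hφ : ∀ B, φ B = Aᵀ * (B * A) := fun B => rfl
  have hform : ∀ B w, w ⬝ᵥ (φ B) *ᵥ w = (A *ᵥ w) ⬝ᵥ B *ᵥ (A *ᵥ w) := by
    intro B w
    rw [hφ, ← mulVec_mulVec, ← mulVec_mulVec, dotProduct_mulVec, vecMul_transpose]
  have hinj : Function.Injective φ := by
    intro B C h
    have hT : A'ᵀ * Aᵀ = 1 := by rw [← transpose_mul, hAA', transpose_one]
    have hrec : ∀ B, A'ᵀ * φ B * A' = B := fun B => by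
      rw [hφ, ← mul_assoc A'ᵀ, hT, one_mul, mul_assoc, hAA', mul_one]
    rw [← hrec B, h, hrec]
  have hK : K.map φ = K := by
    apply Submodule.eq_of_le_of_finrank_eq
    · rintro _ ⟨B, hB, rfl⟩ a b
      obtain ⟨u, v, huv⟩ := hV a b
      rw [hform, huv]
      exact hB u v
    · exact (Submodule.equivMapOfInjective φ hinj K).symm.finrank_eq
  intro a b
  rw [isProductVec_iff_minors]
  intro i j k l
  have hsingle : ∀ (p q : Fin d × Fin d) (w : Fin d × Fin d → ℂ),
      w ⬝ᵥ single p q (1 : ℂ) *ᵥ w = w p * w q := fun p q w => by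
    rw [single_mulVec, one_mul]
    exact dotProduct_single w (w q) p
  -- The minor, as a quadratic form, lies in K, hence is φ C for some C in K; evaluating at V⁻¹(a ⊗
  -- b) then reads off the minor there.
  have hB : single (i, j) (k, l) (1 : ℂ) - single (i, l) (k, j) 1 ∈ K := by
    intro a b
    rw [sub_mulVec, dotProduct_sub, hsingle, hsingle, sub_eq_zero]
    simp only [prodVec]
    ring
  rw [← hK] at hB
  obtain ⟨C, hC, hCB⟩ := hB
  have h1 := hform C (A' *ᵥ prodVec a b)
  rw [mulVec_mulVec _ A, hAA', one_mulVec, hC a b, hCB, sub_mulVec, dotProduct_sub, hsingle,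
    hsingle, sub_eq_zero] at h1
  exact h1

/-! ### Linear spaces of decomposable vectors. -/

/-- A linear space of decomposable vectors has a common left factor or a common right factor. -/
theorem exists_common_factor {E m n : Type*} [AddCommGroup E] [Module ℂ E]
    (g : E →ₗ[ℂ] (m × n → ℂ)) (hg : ∀ y, IsProductVec (g y)) :
    (∃ u, ∀ y, ∃ b, g y = prodVec u b) ∨ (∃ v, ∀ y, ∃ a, g y = prodVec a v) := by
  by_cases h0 : ∀ y, g y = 0
  · exact Or.inl ⟨0, fun y => ⟨0, by rw [h0]; funext p; simp [prodVec]⟩⟩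
  push Not at h0
  obtain ⟨y₀, hy₀⟩ := h0
  obtain ⟨u, v, huv⟩ := hg y₀
  have hu : u ≠ 0 := by rintro rfl; exact hy₀ (by rw [huv]; funext p; simp [prodVec])
  have hv : v ≠ 0 := by rintro rfl; exact hy₀ (by rw [huv]; funext p; simp [prodVec])
  obtain ⟨k, hk⟩ := Function.ne_iff.1 hu
  obtain ⟨l, hl⟩ := Function.ne_iff.1 hv
  simp only [Pi.zero_apply] at hk hl
  have key : ∀ y, (∃ b, g y = prodVec u b) ∨ (∃ a, g y = prodVec a v) := by
    intro y
    obtain ⟨a, b, hab⟩ := hg y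
    have hs := hg (y + y₀)
    rw [map_add, hab, huv, isProductVec_iff_minors] at hs
    simp only [Pi.add_apply, prodVec] at hs
    -- The minors of a ⊗ b + u ⊗ v factor, so a is proportional to u or b to v.
    have hs' : ∀ i j, (a i * u k - u i * a k) * (b j * v l - b l * v j) = 0 := by
      intro i j
      linear_combination hs i j k l
    by_cases hi : ∀ i, a i * u k - u i * a k = 0
    · left
      refine ⟨(a k / u k) • b, ?_⟩
      rw [hab]
      funext p
      simp only [prodVec, Pi.smul_apply, smul_eq_mul]
      field_simp
      linear_combination b p.2 * hi p.1
    · right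
      push Not at hi
      obtain ⟨i, hi⟩ := hi
      refine ⟨(b l / v l) • a, ?_⟩
      rw [hab]
      funext p
      simp only [prodVec, Pi.smul_apply, smul_eq_mul]
      have := (mul_eq_zero.1 (hs' i p.2)).resolve_left hi
      field_simp
      linear_combination a p.1 * this
  -- A vector space is not the union of two proper subspaces.
  by_contra hcon
  push Not at hcon
  obtain ⟨⟨y, hy⟩, ⟨y', hy'⟩⟩ := And.imp (fun h => h u) (fun h => h v) hcon
  obtain ⟨a, ha⟩ := (key y).resolve_left (fun ⟨b, hb⟩ => hy b hb)
  obtain ⟨b, hb⟩ := (key y').resolve_right (fun ⟨a, ha⟩ => hy' a ha)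
  rcases key (y + y') with ⟨c, hc⟩ | ⟨c, hc⟩
  · apply hy (c - b)
    rw [map_add, hb] at hc
    funext p
    have := congrFun hc p
    simp only [Pi.add_apply, prodVec, Pi.sub_apply] at this ⊢
    linear_combination this
  · apply hy' (c - a)
    rw [map_add, ha] at hc
    funext p
    have := congrFun hc p
    simp only [Pi.add_apply, prodVec, Pi.sub_apply] at this ⊢
    linear_combination this

theorem sum_vecMulVec_of_left_factor {n : Type*} [Fintype n] [DecidableEq n] [Nonempty n]
    {w : n → n × n → ℂ} (hw : ∀ j k, star (w j) ⬝ᵥ w k = if j = k then 1 else 0) {u : n → ℂ}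
    (hu : ∀ j, ∃ b, w j = prodVec u b) :
    ∃ u' : n → ℂ, star u' ⬝ᵥ u' = 1 ∧
      ∑ j, vecMulVec (w j) (star (w j)) = vecMulVec u' (star u') ⊗ₖ (1 : Matrix n n ℂ) := by
  choose b hb using hu
  have hu0 : u ≠ 0 := by
    rintro rfl
    obtain ⟨j⟩ := ‹Nonempty n›
    have := hw j j
    rw [hb, star_prodVec, prodVec_dotProduct_prodVec] at this
    simp at this
  obtain ⟨c, u', -, hu', rfl⟩ := exists_smul_unit hu0
  refine ⟨u', hu', ?_⟩
  have hb' : ∀ j, w j = prodVec u' (c • b j) := fun j => by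
    rw [hb, prodVec_smul, ← smul_prodVec]
  let M : Matrix n n ℂ := of fun i j => (c • b j) i
  -- Orthonormality of the w j passes to the right factors. M is square, so its columns form a basis
  -- and their projections sum to 1.
  have hM : Mᴴ * M = 1 := by
    ext j k
    have := hw j k
    rw [hb', hb', star_prodVec, prodVec_dotProduct_prodVec, hu', one_mul] at this
    rw [one_apply, ← this]
    rfl
  have hM' : ∑ j, vecMulVec (c • b j) (star (c • b j)) = 1 := by
    rw [← mul_eq_one_comm.1 hM]
    ext i k
    simp only [Matrix.sum_apply, vecMulVec_apply, mul_apply]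
    rfl
  simp only [hb', star_prodVec, vecMulVec_prodVec]
  rw [← hM']
  ext p q
  simp only [Matrix.sum_apply, kroneckerMap_apply, Finset.mul_sum]

theorem sum_vecMulVec_of_right_factor {n : Type*} [Fintype n] [DecidableEq n] [Nonempty n]
    {w : n → n × n → ℂ} (hw : ∀ j k, star (w j) ⬝ᵥ w k = if j = k then 1 else 0) {v : n → ℂ}
    (hv : ∀ j, ∃ a, w j = prodVec a v) :
    ∃ v' : n → ℂ, star v' ⬝ᵥ v' = 1 ∧
      ∑ j, vecMulVec (w j) (star (w j)) = (1 : Matrix n n ℂ) ⊗ₖ vecMulVec v' (star v') := by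
  obtain ⟨v', hv', h⟩ := sum_vecMulVec_of_left_factor (w := fun j p => w j p.swap) (u := v)
    (fun j k => by
      rw [← hw j k]
      exact Equiv.sum_comp (Equiv.prodComm n n) fun p => star (w j p) * w k p)
    (fun j => by
      obtain ⟨a, ha⟩ := hv j
      exact ⟨a, by funext p; simp [ha, prodVec, mul_comm]⟩)
  refine ⟨v', hv', ?_⟩
  ext p q
  have := congrFun (congrFun h p.swap) q.swap
  simp only [Matrix.sum_apply, vecMulVec_apply, kroneckerMap_apply, Pi.star_apply, Prod.swap_swap,
    Prod.fst_swap] at this ⊢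
  exact this.trans (mul_comm _ _)

theorem sum_vecMulVec_single {n : Type*} [Fintype n] [DecidableEq n] :
    ∑ j : n, vecMulVec (Pi.single j (1 : ℂ)) (star (Pi.single j (1 : ℂ))) = (1 : Matrix n n ℂ) := by
  ext i k
  simp [Matrix.sum_apply, vecMulVec_apply, one_apply, Pi.single_apply]

theorem star_single_dotProduct_single {n : Type*} [Fintype n] [DecidableEq n] (j k : n) :
    star (Pi.single j (1 : ℂ) : n → ℂ) ⬝ᵥ Pi.single k 1 = if j = k then 1 else 0 := by
  simp [Pi.single_apply, eq_comm]

theorem unitary_conj_sum_vecMulVec {n ι : Type*} [Fintype n] [DecidableEq n] [Fintype ι]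
    (V : unitaryGroup n ℂ) (w : ι → n → ℂ) :
    (V : Matrix n n ℂ) * (∑ j, vecMulVec (w j) (star (w j))) * (V : Matrix n n ℂ)ᴴ =
      ∑ j, vecMulVec ((V : Matrix n n ℂ) *ᵥ w j) (star ((V : Matrix n n ℂ) *ᵥ w j)) := by
  simp only [star_mulVec, ← vecMulVec_mul, ← mul_vecMulVec, Finset.mul_sum, Finset.sum_mul,
    mul_assoc]

/-- An isometry from `ℂ^n` to `ℂ^n ⊗ ℂ^n` with decomposable values has range projection
`u uᴴ ⊗ 1` or `1 ⊗ u uᴴ`. -/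
theorem range_projection_of_product {n : Type*} [Fintype n] [DecidableEq n] [Nonempty n]
    (g : (n → ℂ) →ₗ[ℂ] (n × n → ℂ)) (hg : ∀ y, IsProductVec (g y))
    (hw : ∀ j k, star (g (Pi.single j 1)) ⬝ᵥ g (Pi.single k 1) = if j = k then 1 else 0) :
    ∃ u : n → ℂ, star u ⬝ᵥ u = 1 ∧
      (∑ j, vecMulVec (g (Pi.single j 1)) (star (g (Pi.single j 1))) =
          vecMulVec u (star u) ⊗ₖ (1 : Matrix n n ℂ) ∨
        ∑ j, vecMulVec (g (Pi.single j 1)) (star (g (Pi.single j 1))) =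
          (1 : Matrix n n ℂ) ⊗ₖ vecMulVec u (star u)) := by
  rcases exists_common_factor g hg with ⟨u, hu⟩ | ⟨v, hv⟩
  · obtain ⟨u', h1, h2⟩ := sum_vecMulVec_of_left_factor hw fun j => hu _
    exact ⟨u', h1, Or.inl h2⟩
  · obtain ⟨u', h1, h2⟩ := sum_vecMulVec_of_right_factor hw fun j => hv _
    exact ⟨u', h1, Or.inr h2⟩

/-! ### Primitive gates conjugate local phase gates into H. -/

theorem conj_mem_of_phases {d : ℕ} {V g : TwoGate d} {z : Circle}
    {P : Matrix (Fin d × Fin d) (Fin d × Fin d) ℂ} {u : Fin d → ℂ} (hu : star u ⬝ᵥ u = 1)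
    (hg : (g : Matrix (Fin d × Fin d) (Fin d × Fin d) ℂ) = 1 + ((z : ℂ) - 1) • P)
    (h : (V : Matrix (Fin d × Fin d) (Fin d × Fin d) ℂ) * P *
        (V : Matrix (Fin d × Fin d) (Fin d × Fin d) ℂ)ᴴ =
          vecMulVec u (star u) ⊗ₖ (1 : Matrix (Fin d) (Fin d) ℂ) ∨
      (V : Matrix (Fin d × Fin d) (Fin d × Fin d) ℂ) * P *
        (V : Matrix (Fin d × Fin d) (Fin d × Fin d) ℂ)ᴴ =
          (1 : Matrix (Fin d) (Fin d) ℂ) ⊗ₖ vecMulVec u (star u)) :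
    V * g * V⁻¹ ∈ tensorSubgroup d := by
  have hVg : ((V * g * V⁻¹ : TwoGate d) : Matrix (Fin d × Fin d) (Fin d × Fin d) ℂ) =
      1 + ((z : ℂ) - 1) • ((V : Matrix (Fin d × Fin d) (Fin d × Fin d) ℂ) * P *
        (V : Matrix (Fin d × Fin d) (Fin d × Fin d) ℂ)ᴴ) := by
    rw [← unitary_conj_one_add_smul, ← hg]
    rfl
  rcases h with h | h
  · refine ⟨phaseGate z u hu, 1, Subtype.ext ?_⟩
    rw [hVg, h, coe_tensorGate_phaseGate_one]
  · refine ⟨1, phaseGate z u hu, Subtype.ext ?_⟩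
    rw [hVg, h, coe_tensorGate_one_phaseGate]

theorem IsPrimitive.conj_phaseGate_one_mem {d : ℕ} {V : TwoGate d} (hV : IsPrimitive V)
    (z : Circle) (x : Fin d → ℂ) (hx : star x ⬝ᵥ x = 1) :
    V * tensorGate (phaseGate z x hx) 1 * V⁻¹ ∈ tensorSubgroup d := by
  rw [isPrimitive_iff] at hV
  have : Nonempty (Fin d) := by
    by_contra h
    rw [not_nonempty_iff] at h
    simp [dotProduct] at hx
  let g : (Fin d → ℂ) →ₗ[ℂ] (Fin d × Fin d → ℂ) :=
    (mulVecLin (V : Matrix (Fin d × Fin d) (Fin d × Fin d) ℂ)).comp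
      ({ toFun := fun y => prodVec x y
         map_add' := fun y y' => by funext p; simp [prodVec, mul_add]
         map_smul' := fun c y => prodVec_smul c x y } : (Fin d → ℂ) →ₗ[ℂ] (Fin d × Fin d → ℂ))
  have hg : ∀ y, g y = (V : Matrix (Fin d × Fin d) (Fin d × Fin d) ℂ) *ᵥ prodVec x y :=
    fun y => rfl
  obtain ⟨u, hu, h⟩ := range_projection_of_product g (fun y => hV x y) fun j k => by
    rw [hg, hg, star_mulVec_dotProduct_mulVec, star_prodVec, prodVec_dotProduct_prodVec, hx,
      one_mul, star_single_dotProduct_single]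
  refine conj_mem_of_phases hu (coe_tensorGate_phaseGate_one z x hx) ?_
  -- Expands xxᴴ ⊗ 1 as the sum of the projections onto x ⊗ e_j.
  convert h using 2 <;>
  · simp only [hg]
    rw [← unitary_conj_sum_vecMulVec, ← sum_vecMulVec_single]
    congr 2
    simp only [star_prodVec, vecMulVec_prodVec]
    ext p q
    simp only [Matrix.sum_apply, kroneckerMap_apply, Finset.mul_sum]

theorem IsPrimitive.conj_one_phaseGate_mem {d : ℕ} {V : TwoGate d} (hV : IsPrimitive V)
    (z : Circle) (y : Fin d → ℂ) (hy : star y ⬝ᵥ y = 1) :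
    V * tensorGate 1 (phaseGate z y hy) * V⁻¹ ∈ tensorSubgroup d := by
  rw [isPrimitive_iff] at hV
  have : Nonempty (Fin d) := by
    by_contra h
    rw [not_nonempty_iff] at h
    simp [dotProduct] at hy
  let g : (Fin d → ℂ) →ₗ[ℂ] (Fin d × Fin d → ℂ) :=
    (mulVecLin (V : Matrix (Fin d × Fin d) (Fin d × Fin d) ℂ)).comp
      ({ toFun := fun x => prodVec x y
         map_add' := fun x x' => by funext p; simp [prodVec, add_mul]
         map_smul' := fun c x => (smul_prodVec c x y).symm } :
        (Fin d → ℂ) →ₗ[ℂ] (Fin d × Fin d → ℂ))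
  have hg : ∀ x, g x = (V : Matrix (Fin d × Fin d) (Fin d × Fin d) ℂ) *ᵥ prodVec x y :=
    fun x => rfl
  obtain ⟨u, hu, h⟩ := range_projection_of_product g (fun x => hV x y) fun j k => by
    rw [hg, hg, star_mulVec_dotProduct_mulVec, star_prodVec, prodVec_dotProduct_prodVec, hy,
      mul_one, star_single_dotProduct_single]
  refine conj_mem_of_phases hu (coe_tensorGate_one_phaseGate z y hy) ?_
  convert h using 2 <;>
  · simp only [hg]
    rw [← unitary_conj_sum_vecMulVec, ← sum_vecMulVec_single]
    congr 2
    simp only [star_prodVec, vecMulVec_prodVec]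
    ext p q
    simp only [Matrix.sum_apply, kroneckerMap_apply, Finset.sum_mul]

/-! ### Generation of the unitary group by phase gates. -/

/-- A unitary `U ≠ 1` has a unit eigenvector which is orthogonal to the fixed vectors of `U`. -/
theorem exists_eigenvector_orthogonal_fixed {n : Type*} [Fintype n] [DecidableEq n]
    {U : unitaryGroup n ℂ} (hU : U ≠ 1) :
    ∃ (z : Circle) (v : n → ℂ), star v ⬝ᵥ v = 1 ∧ (U : Matrix n n ℂ) *ᵥ v = (z : ℂ) • v ∧
      ∀ y, (U : Matrix n n ℂ) *ᵥ y = y → star v ⬝ᵥ y = 0 := by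
  let f : Module.End ℂ (n → ℂ) := mulVecLin (U : Matrix n n ℂ)
  have hf : ∀ x, f x = (U : Matrix n n ℂ) *ᵥ x := fun x => rfl
  -- The range of U - 1 is invariant, nonzero, and orthogonal to the fixed vectors because U
  -- preserves inner products.
  let R : Submodule ℂ (n → ℂ) := LinearMap.range (f - 1)
  have hR : ∀ x ∈ R, f x ∈ R := by
    rintro _ ⟨w, rfl⟩
    exact ⟨f w, by simp⟩
  have hR0 : R ≠ ⊥ := by
    intro h
    rw [LinearMap.range_eq_bot, sub_eq_zero] at h
    apply hU
    apply Subtype.ext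
    apply Matrix.toLin'.injective
    rw [UnitaryGroup.one_val, Matrix.toLin'_one]
    exact h
  have : Nontrivial R := Submodule.nontrivial_iff_ne_bot.2 hR0
  obtain ⟨μ, hμ⟩ := Module.End.exists_eigenvalue (f.restrict hR)
  obtain ⟨⟨v, hvR⟩, hv⟩ := hμ.exists_hasEigenvector
  have hv1 : f v = μ • v := congrArg Subtype.val hv.apply_eq_smul
  have hv0 : v ≠ 0 := fun h => hv.2 (Subtype.ext h)
  obtain ⟨c, v, hc, hvu, rfl⟩ := exists_smul_unit hv0
  have hv2 : (U : Matrix n n ℂ) *ᵥ v = μ • v := by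
    rw [map_smul, smul_comm] at hv1
    exact smul_right_injective _ hc hv1
  have hμ1 : μ ∈ Submonoid.unitSphere ℂ := by
    have := star_mulVec_dotProduct_mulVec U v v
    rw [hv2, star_smul, smul_dotProduct, dotProduct_smul, hvu, smul_eq_mul, smul_eq_mul,
      mul_one, RCLike.star_def, ← Complex.normSq_eq_conj_mul_self, Complex.normSq_eq_norm_sq] at this
    have h2 : ‖μ‖ ^ 2 = 1 := by exact_mod_cast this
    exact mem_sphere_zero_iff_norm.2
      ((pow_eq_one_iff_of_nonneg (norm_nonneg μ) two_ne_zero).1 h2)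
  refine ⟨⟨μ, hμ1⟩, v, hvu, hv2, fun y hy => ?_⟩
  obtain ⟨w, hw⟩ := hvR
  have h1 : star (c • v) ⬝ᵥ y = 0 := by
    have h2 := star_mulVec_dotProduct_mulVec U w y
    rw [hy] at h2
    rw [← hw, LinearMap.sub_apply, star_sub, sub_dotProduct, hf, h2]
    exact sub_self _
  rw [star_smul, smul_dotProduct, smul_eq_mul] at h1
  exact (mul_eq_zero.1 h1).resolve_left (star_ne_zero.2 hc)

/-- The unitary group is generated by the phase gates. -/
theorem closure_phaseGate {n : Type*} [Fintype n] [DecidableEq n] :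
    Subgroup.closure {U : unitaryGroup n ℂ | ∃ z u hu, U = phaseGate z u hu} = ⊤ := by
  rw [eq_top_iff]
  rintro U -
  induction hk : Fintype.card n -
      Module.finrank ℂ (LinearMap.ker (mulVecLin (U : Matrix n n ℂ) - 1)) using Nat.strong_induction_on
      generalizing U with
  | _ k ih =>
  by_cases hU : U = 1
  · rw [hU]; exact one_mem _
  obtain ⟨z, v, hv, hUv, horth⟩ := exists_eigenvector_orthogonal_fixed hU
  -- Undoing the phase z on v keeps every fixed vector and adds v, so the codimension of the fixed
  -- space drops.
  have hlt : LinearMap.ker (mulVecLin (U : Matrix n n ℂ) - 1) <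
      LinearMap.ker (mulVecLin ((phaseGate z⁻¹ v hv * U : unitaryGroup n ℂ) : Matrix n n ℂ) - 1) := by
    have hmem : ∀ (A : Matrix n n ℂ) x, x ∈ LinearMap.ker (mulVecLin A - 1) ↔ A *ᵥ x = x := by
      intro A x
      rw [LinearMap.mem_ker, LinearMap.sub_apply, sub_eq_zero]
      rfl
    refine lt_of_le_of_ne (fun y hy => ?_) fun h => ?_
    · rw [hmem] at hy ⊢
      rw [UnitaryGroup.mul_val, ← mulVec_mulVec, hy, phaseGate_mulVec, horth y hy, mul_zero,
        zero_smul, add_zero]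
    · have hvk : v ∈ LinearMap.ker (mulVecLin (U : Matrix n n ℂ) - 1) := by
        rw [h, hmem, UnitaryGroup.mul_val, ← mulVec_mulVec, hUv, phaseGate_mulVec,
          dotProduct_smul, hv, ← add_smul]
        convert one_smul ℂ v
        have : (z : ℂ) ≠ 0 := Circle.coe_ne_zero z
        simp only [Circle.coe_inv, smul_eq_mul, mul_one]
        field_simp
        ring
      have := horth v ((hmem _ _).1 hvk)
      rw [hv] at this
      exact one_ne_zero this
  have h1 := Submodule.finrank_lt_finrank_of_lt hlt
  have h2 := Submodule.finrank_le (LinearMap.ker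
    (mulVecLin ((phaseGate z⁻¹ v hv * U : unitaryGroup n ℂ) : Matrix n n ℂ) - 1))
  rw [Module.finrank_fintype_fun_eq_card] at h2
  have h3 : phaseGate z⁻¹ v hv * U ∈
      Subgroup.closure {U : unitaryGroup n ℂ | ∃ z u hu, U = phaseGate z u hu} :=
    ih _ (by rw [← hk]; exact Nat.sub_lt_sub_left (h1.trans_le h2) h1) rfl
  have h4 : phaseGate z⁻¹ v hv ∈
      Subgroup.closure {U : unitaryGroup n ℂ | ∃ z u hu, U = phaseGate z u hu} :=
    Subgroup.subset_closure ⟨_, _, _, rfl⟩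
  exact (Subgroup.mul_mem_cancel_left _ h4).1 h3

/-! ### Primitive gates normalize H. -/

theorem IsPrimitive.conj_mem {d : ℕ} {V : TwoGate d} (hV : IsPrimitive V) {g : TwoGate d}
    (hg : g ∈ tensorSubgroup d) : V * g * V⁻¹ ∈ tensorSubgroup d := by
  let N := (tensorSubgroup d).comap (MulAut.conj V).toMonoidHom
  let ι₁ : OneGate d →* TwoGate d :=
    { toFun := fun A => tensorGate A 1
      map_one' := tensorGate_one d
      map_mul' := fun A B => by rw [tensorGate_mul, one_mul] }
  let ι₂ : OneGate d →* TwoGate d :=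
    { toFun := fun A => tensorGate 1 A
      map_one' := tensorGate_one d
      map_mul' := fun A B => by rw [tensorGate_mul, one_mul] }
  have h₁ : N.comap ι₁ = ⊤ := by
    rw [eq_top_iff, ← closure_phaseGate, Subgroup.closure_le]
    rintro _ ⟨z, u, hu, rfl⟩
    exact hV.conj_phaseGate_one_mem z u hu
  have h₂ : N.comap ι₂ = ⊤ := by
    rw [eq_top_iff, ← closure_phaseGate, Subgroup.closure_le]
    rintro _ ⟨z, u, hu, rfl⟩
    exact hV.conj_one_phaseGate_mem z u hu
  obtain ⟨S, T, rfl⟩ := hg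
  have hS : S ∈ N.comap ι₁ := h₁ ▸ Subgroup.mem_top S
  have hT : T ∈ N.comap ι₂ := h₂ ▸ Subgroup.mem_top T
  have hST : tensorGate S T = ι₁ S * ι₂ T := by
    change _ = tensorGate S 1 * tensorGate 1 T
    rw [tensorGate_mul, mul_one, one_mul]
  rw [hST]
  exact N.mul_mem hS hT

end QuditGates

theorem mainTheorem5 (d : ℕ) :
    (Subgroup.normalizer (QuditGates.tensorSubgroup d : Set (QuditGates.TwoGate d)) :
        Set (QuditGates.TwoGate d)) =
      {V : QuditGates.TwoGate d | QuditGates.IsPrimitive V} := by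
  ext V
  rw [SetLike.mem_coe, Subgroup.mem_normalizer_iff, Set.mem_ofPred_eq]
  constructor
  · exact fun h => QuditGates.isPrimitive_of_conj_mem fun g hg => (h g).1 hg
  · refine fun hV g => ⟨hV.conj_mem, fun hg => ?_⟩
    have := hV.inv.conj_mem hg
    rwa [inv_inv, ← mul_assoc, inv_mul_cancel_right, inv_mul_cancel_left] at this
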